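/- Let $(X_n)_{n\ge 0}$ be a Galton--Watson process with immigration, that is, $X_n=\sum_{i=1}^{X_{n-1}}\xi_{n,i}+\varepsilon_n$ for $n\ge 1$ (with $\sum_{i=1}^{0}:=0$), where $\{X_0,\ \xi_{n,i},\ \varepsilon_n : n,i\ge 1\}$ are independent non-negative integer-valued random variables on a probability space, the $\xi_{n,i}$ $(n,i\ge1)$ are identically distributed, and the $\varepsilon_n$ $(n\ge 1)$ are identically distributed. Write $\xi=\xi_{1,1}$, $\varepsilon=\varepsilon_1$ and $m_\xi=\mathbb{E}(\xi)$. A non-negative random variable $Y$ is called regularly varying with index $\alpha\ge 0$ if $\mathbb{P}(Y>x)>0$ for all $x>0$ and $\lim_{x\to\infty}\mathbb{P}(Y>qx)/\mathbb{P}(Y>x)=q^{-\alpha}$ for all $q>0$. Suppose that $X_0$ is regularly varying with index $\beta\ge 0$, that $\mathbb{P}(\xi=0)<1$, and that there exists $r>\max(1,\beta)$ with $\mathbb{E}(\xi^r)<\infty$ and $\mathbb{E}(\varepsilon^r)<\infty$. Then for every integer $n\ge 1$, $$\mathbb{P}(X_n>x)\sim m_\xi^{n\beta}\,\mathbb{P}(X_0>x)\qquad\text{as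 } x\to\infty,$$ i.e. the ratio of the two sides tends to $1$, and hence $X_n$ is also regularly varying with index $\beta$. -/

import Mathlib

open MeasureTheory ProbabilityTheory Filter Topology

/-- A measurable function `U : (0, ∞) → (0, ∞)` is regularly varying at infinity with index `ρ` if
`U (q x) / U x → q ^ ρ` as `x → ∞`, for every `q > 0`. Only the values of `U` on `(0, ∞)`
matter. -/
structure IsRegularlyVarying (U : ℝ → ℝ) (ρ : ℝ) : Prop where
  pos : ∀ x : ℝ, 0 < x → 0 < U x
  measurable : Measurable ((Set.Ioi (0 : ℝ)).domRestrict U)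
  tendsto : ∀ q : ℝ, 0 < q → Tendsto (fun x : ℝ => U (q * x) / U x) atTop (𝓝 (q ^ ρ))

/-- A non-negative random variable `Y` is regularly varying with index `α ≥ 0` if
`x ↦ P(Y > x)` is positive on `(0, ∞)` and regularly varying at infinity with index `-α`. -/
structure IsRegularlyVaryingRV {Ω : Type*} [MeasurableSpace Ω] (Y : Ω → ℝ) (α : ℝ)
    (P : Measure Ω) : Prop where
  measurable : Measurable Y
  nonneg : ∀ ω, 0 ≤ Y ω
  index_nonneg : 0 ≤ α
  tail : IsRegularlyVarying (fun x : ℝ => P.real {ω | x < Y ω}) (-α)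

/-- The combined family `{X₀, ξₙᵢ, εₙ}` of the initial value, the offspring variables and the
immigration variables, over the index set `{*} ⊔ (ℕ × ℕ) ⊔ ℕ`. -/
def gwiFamily {Ω : Type*} (X₀ : Ω → ℕ) (ξ : ℕ → ℕ → Ω → ℕ) (ε : ℕ → Ω → ℕ) :
    Unit ⊕ (ℕ × ℕ) ⊕ ℕ → Ω → ℕ
  | Sum.inl _ => X₀
  | Sum.inr (Sum.inl p) => ξ p.1 p.2
  | Sum.inr (Sum.inr n) => ε n

/-- `X` is a Galton--Watson process with immigration, with offspring variables `ξ` and immigration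
variables `ε`. Offspring and immigration are indexed from `0`: `ξ n i` is the number of children of
the individual `i` of generation `n` (usually written `ξ` with indices `n + 1`, `i + 1`), and `ε n`
is the immigration into generation `n + 1`. -/
structure IsGWI {Ω : Type*} [MeasurableSpace Ω] (X : ℕ → Ω → ℕ) (ξ : ℕ → ℕ → Ω → ℕ)
    (ε : ℕ → Ω → ℕ) (P : Measure Ω) : Prop where
  measurable_init : Measurable (X 0)
  measurable_offspring : ∀ n i, Measurable (ξ n i)
  measurable_immigration : ∀ n, Measurable (ε n)
  indep : iIndepFun (gwiFamily (X 0) ξ ε) P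
  identDistrib_offspring : ∀ n i, IdentDistrib (ξ n i) (ξ 0 0) P P
  identDistrib_immigration : ∀ n, IdentDistrib (ε n) (ε 0) P P
  recursion : ∀ n ω, X (n + 1) ω = (∑ i ∈ Finset.range (X n ω), ξ n i ω) + ε n ω

/-! By induction on the generation, everything reduces to one random sum `S = ξ_0 + ... + ξ_{N-1} +
e` with regularly varying `N` and lighter `ξ`, `e`: then `S` is large essentially only because `N`
is, and `P(S > x) ~ P(N > x / m) ~ m ^ β * P(N > x)`, where `m` is the offspring mean.

Lower bound (`exists_le_tail_randomSum`): for `q < m`, if `N > x / q`, the law of large numbers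
pushes the sum above `x`.

Upper bound (`exists_tail_randomSum_le`): for `q > m`, if `S > x` but `N ≤ x / q`, then either `e`
exceeds `η x`, or some summand actually used exceeds `η x`, or a truncated sum of `⌊x / q⌋` terms is
well above its mean. The first event is handled by Markov's inequality, the last by a Chernoff
bound; both are `O(x ^ (-r)) = o(P(N > x))`. The middle one is summed using the independence of `N`
and `ξ_i`, and a Potter bound controls `∑ P(N > i)`. Letting `q → m` gives the limit. -/

/-! ### Potter bound and negligible terms -/

/-- A one-sided Potter bound for bounded decreasing regularly varying functions. -/
theorem IsRegularlyVarying.exists_le_mul_rpow {F : ℝ → ℝ} {β b : ℝ}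
    (hF : IsRegularlyVarying F (-β)) (anti : Antitone F) (h1 : ∀ x, F x ≤ 1)
    (hb : β < b) (hb0 : 0 ≤ b) :
    ∃ C > 0, ∃ x₀ > 0, ∀ x y, x₀ ≤ x → 0 < y → y ≤ x → F y ≤ C * (x / y) ^ b * F x := by
  have hlt : (2 : ℝ) ^ (-b) < 2 ^ (-β) := Real.rpow_lt_rpow_of_exponent_lt one_lt_two (by linarith)
  have hev := ((hF.tendsto 2 two_pos).eventually (lt_mem_nhds hlt)).and (eventually_ge_atTop 1)
  obtain ⟨x₀, hx₀⟩ := eventually_atTop.1 hev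
  have hx₀1 : 1 ≤ x₀ := (hx₀ x₀ le_rfl).2
  have hx₀0 : 0 < x₀ := by linarith
  have step : ∀ x, x₀ ≤ x → F x ≤ 2 ^ b * F (2 * x) := by
    intro x hx
    have h := (hx₀ x hx).1
    have hp := hF.pos x (by linarith)
    rw [lt_div_iff₀ hp, Real.rpow_neg two_pos.le, inv_mul_lt_iff₀ (by positivity)] at h
    exact h.le
  have iter : ∀ (n : ℕ) x, x₀ ≤ x → F x ≤ (2 ^ b) ^ n * F (2 ^ n * x) := by
    intro n
    induction n with
    | zero => intro x _; simp
    | succ n ih =>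
      intro x hx
      have h2 : x₀ ≤ 2 ^ n * x := by
        have : (1 : ℝ) ≤ 2 ^ n := one_le_pow₀ one_le_two
        nlinarith
      calc F x ≤ (2 ^ b) ^ n * F (2 ^ n * x) := ih x hx
        _ ≤ (2 ^ b) ^ n * (2 ^ b * F (2 * (2 ^ n * x))) := by gcongr; exact step _ h2
        _ = _ := by rw [pow_succ, pow_succ]; ring_nf
  have core : ∀ x y, x₀ ≤ y → y ≤ x → F y ≤ 2 ^ b * (x / y) ^ b * F x := by
    intro x y hy hyx
    have hy0 : 0 < y := by linarith
    -- The dyadic point `2 ^ (n + 1) * y` overshoots `x` by a factor of at most 2, which costs the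
    -- constant `2 ^ b`.
    obtain ⟨n, hn, hn'⟩ := exists_nat_pow_near ((one_le_div hy0).2 hyx) one_lt_two
    have hFx := hF.pos x (by linarith)
    have hle : F (2 ^ (n + 1) * y) ≤ F x := anti ((div_lt_iff₀ hy0).1 hn').le
    calc F y ≤ (2 ^ b) ^ (n + 1) * F (2 ^ (n + 1) * y) := iter _ y hy
      _ ≤ (2 ^ b) ^ (n + 1) * F x := by gcongr
      _ = 2 ^ b * ((2 : ℝ) ^ n) ^ b * F x := by
        rw [pow_succ', ← Real.rpow_natCast, ← Real.rpow_mul two_pos.le, mul_comm b,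
          Real.rpow_mul two_pos.le, Real.rpow_natCast]
      _ ≤ _ := by gcongr
  have hFx₀ := hF.pos x₀ hx₀0
  have hinv : 1 ≤ (F x₀)⁻¹ := (one_le_inv₀ hFx₀).2 (h1 _)
  -- The factor `(F x₀)⁻¹ ≥ 1` covers `y < x₀`: there `F y ≤ 1`, and the bound is compared with the
  -- one at `x₀`.
  refine ⟨2 ^ b * (F x₀)⁻¹, by positivity, x₀, hx₀0, fun x y hx hy hyx => ?_⟩
  have hFx := hF.pos x (by linarith)
  have hx0 : 0 < x := by linarith
  rcases le_total x₀ y with h | h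
  · refine (core x y h hyx).trans ?_
    have : 0 ≤ 2 ^ b * (x / y) ^ b * F x := by positivity
    nlinarith
  · have h3 := core x x₀ le_rfl hx
    have h4 : 1 ≤ (F x₀)⁻¹ * (2 ^ b * (x / x₀) ^ b * F x) := by
      rw [le_inv_mul_iff₀ hFx₀]; simpa using h3
    have h5 : (x / x₀) ^ b ≤ (x / y) ^ b := by gcongr
    calc F y ≤ 1 := h1 y
      _ ≤ (F x₀)⁻¹ * (2 ^ b * (x / x₀) ^ b * F x) := h4
      _ ≤ (F x₀)⁻¹ * (2 ^ b * (x / y) ^ b * F x) := by gcongr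
      _ = _ := by ring

theorem IsRegularlyVarying.tendsto_comp_div {F : ℝ → ℝ} {β : ℝ}
    (hF : IsRegularlyVarying F (-β)) {q : ℝ} (hq : 0 < q) :
    Tendsto (fun x => F (x / q) / F x) atTop (𝓝 (q ^ β)) := by
  have h := hF.tendsto q⁻¹ (by positivity)
  rw [Real.inv_rpow hq.le, Real.rpow_neg hq.le, inv_inv] at h
  simpa [div_eq_inv_mul] using h

/-- For `β < b < r`, the Potter bound with `y = x₀` fixed gives `F x ≥ c * x ^ (-b)`, leaving a
spare factor `x ^ (-(r - b))`. -/
theorem IsRegularlyVarying.tendsto_rpow_neg_div {F : ℝ → ℝ} {β r : ℝ}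
    (hF : IsRegularlyVarying F (-β)) (anti : Antitone F) (h1 : ∀ x, F x ≤ 1)
    (hβ : 0 ≤ β) (hr : β < r) :
    Tendsto (fun x => x ^ (-r) / F x) atTop (𝓝 0) := by
  obtain ⟨b, hb, hbr⟩ := exists_between hr
  obtain ⟨C, hC, x₀, hx₀, H⟩ := hF.exists_le_mul_rpow anti h1 hb (hβ.trans hb.le)
  have hFx₀ := hF.pos x₀ hx₀
  have hlim : Tendsto (fun x : ℝ => (C * x₀ ^ (-b) * (F x₀)⁻¹) * x ^ (-(r - b))) atTop (𝓝 0) := by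
    simpa using (tendsto_rpow_neg_atTop (sub_pos.2 hbr)).const_mul (C * x₀ ^ (-b) * (F x₀)⁻¹)
  refine squeeze_zero' ?_ ?_ hlim
  · filter_upwards [eventually_gt_atTop 0] with x hx
    have := hF.pos x hx
    positivity
  · filter_upwards [eventually_ge_atTop x₀] with x hx
    have hx0 : 0 < x := by linarith
    have hFx := hF.pos x hx0
    have h := H x x₀ hx hx₀ hx
    rw [Real.div_rpow hx0.le hx₀.le] at h
    rw [div_le_iff₀ hFx, show -(r - b) = -r + b by ring, Real.rpow_add hx0, Real.rpow_neg hx₀.le]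
    have hpos : 0 < x ^ (-r) := by positivity
    calc x ^ (-r) = x ^ (-r) * (F x₀)⁻¹ * F x₀ := by field_simp
      _ ≤ x ^ (-r) * (F x₀)⁻¹ * (C * (x ^ b / x₀ ^ b) * F x) := by gcongr
      _ = _ := by rw [div_eq_mul_inv]; ring

/-- If the tail `F` is regularly varying with index `-β` and `r > max 1 β`, then the sum of `F`
along the integers up to `x / q` is negligible with respect to `x ^ r * F x`. -/
theorem IsRegularlyVarying.tendsto_rpow_neg_mul_sum_div {F : ℝ → ℝ} {β r q : ℝ}
    (hF : IsRegularlyVarying F (-β)) (anti : Antitone F) (h1 : ∀ x, F x ≤ 1)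
    (hr : max 1 β < r) (hq : 0 < q) :
    Tendsto (fun x => x ^ (-r) * (∑ i ∈ Finset.range ⌊x / q⌋₊, F (((i : ℝ) + 1) / 2)) / F x)
      atTop (𝓝 0) := by
  -- `b > β` serves the Potter bound, `b > 1` the summability of `(i + 1) ^ (-b)`, and `b < r` the
  -- final decay.
  obtain ⟨b, hb, hbr⟩ := exists_between hr
  obtain ⟨hb1, hbβ⟩ := max_lt_iff.1 hb
  obtain ⟨C, hC, x₀, hx₀, H⟩ := hF.exists_le_mul_rpow anti h1 hbβ (by linarith)
  have hsum : Summable fun i : ℕ => 1 / ((i : ℝ) + 1) ^ b := by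
    have := (summable_nat_add_iff 1).2 (Real.summable_one_div_nat_rpow.2 hb1)
    simpa using this
  set S := ∑' i : ℕ, 1 / ((i : ℝ) + 1) ^ b with hS
  have hlim : Tendsto (fun x : ℝ => (C * (1 / q) ^ b * S) * x ^ (-(r - b)) *
      (F (x / (2 * q)) / F x)) atTop (𝓝 0) := by
    have h := ((tendsto_rpow_neg_atTop (sub_pos.2 hbr)).const_mul (C * (1 / q) ^ b * S)).mul
      (hF.tendsto_comp_div (q := 2 * q) (by positivity))
    simpa using h
  refine squeeze_zero' ?_ ?_ hlim
  · filter_upwards [eventually_gt_atTop 0] with x hx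
    have := hF.pos x hx
    have : 0 ≤ ∑ i ∈ Finset.range ⌊x / q⌋₊, F (((i : ℝ) + 1) / 2) :=
      Finset.sum_nonneg fun i _ => (hF.pos _ (by positivity)).le
    positivity
  · filter_upwards [eventually_ge_atTop (x₀ * (2 * q)), eventually_gt_atTop 0] with x hx hx0
    have hFx := hF.pos x hx0
    have hFx2 := hF.pos (x / (2 * q)) (by positivity)
    have key : ∑ i ∈ Finset.range ⌊x / q⌋₊, F (((i : ℝ) + 1) / 2) ≤
        C * (x / q) ^ b * F (x / (2 * q)) * S := by
      calc _ ≤ ∑ i ∈ Finset.range ⌊x / q⌋₊,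
            C * (x / q) ^ b * F (x / (2 * q)) * (1 / ((i : ℝ) + 1) ^ b) := by
            refine Finset.sum_le_sum fun i hi => ?_
            have hi' : (i : ℝ) + 1 ≤ x / q := by
              have : i + 1 ≤ ⌊x / q⌋₊ := Finset.mem_range.1 hi
              have h2 := (Nat.le_floor_iff (by positivity)).1 this
              exact_mod_cast h2
            have h := H (x / (2 * q)) (((i : ℝ) + 1) / 2)
              ((le_div_iff₀ (by positivity)).2 hx) (by positivity) (by
                rw [show x / (2 * q) = x / q / 2 by field_simp]; linarith)
            rw [show x / (2 * q) / (((i : ℝ) + 1) / 2) = x / q / ((i : ℝ) + 1) by field_simp,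
              Real.div_rpow (by positivity) (by positivity)] at h
            refine h.trans (le_of_eq ?_)
            rw [div_eq_mul_one_div ((x / q) ^ b)]; ring
        _ = C * (x / q) ^ b * F (x / (2 * q)) *
            ∑ i ∈ Finset.range ⌊x / q⌋₊, (1 / ((i : ℝ) + 1) ^ b) := by rw [Finset.mul_sum]
        _ ≤ _ := by
          gcongr
          exact hsum.sum_le_tsum _ fun i _ => by positivity
    rw [show -(r - b) = -r + b by ring, Real.rpow_add hx0, ← mul_div_assoc]
    refine div_le_div_of_nonneg_right ?_ hFx.le
    calc x ^ (-r) * _ ≤ x ^ (-r) * (C * (x / q) ^ b * F (x / (2 * q)) * S) := by gcongr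
      _ = _ := by rw [div_eq_mul_one_div x q, Real.mul_rpow hx0.le (by positivity)]; ring

/-! ### Chernoff bound for truncated sums -/

/-- Multiply `exp v * (1 - v) ≤ 1` by `1 + v`. -/
theorem Real.exp_le_one_add_add_sq_mul_exp {v : ℝ} (hv : 0 ≤ v) :
    Real.exp v ≤ 1 + v + v ^ 2 * Real.exp v := by
  have h1 : 1 - v ≤ Real.exp (-v) := by linarith [Real.add_one_le_exp (-v)]
  have h2 := Real.add_one_le_exp v
  have h3 : Real.exp v * Real.exp (-v) = 1 := by rw [← Real.exp_add]; simp
  have hpos := Real.exp_pos v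
  have h4 : Real.exp v * (1 - v) ≤ 1 := by nlinarith
  nlinarith

/-- A Chernoff bound for sums of truncated independent non-negative random variables. -/
theorem measureReal_le_sum_min_le {Ω : Type*} [MeasurableSpace Ω] {P : Measure Ω}
    [IsProbabilityMeasure P] {Y : ℕ → Ω → ℝ} (hm : ∀ i, Measurable (Y i)) (h0 : ∀ i ω, 0 ≤ Y i ω)
    (hind : iIndepFun Y P) (hid : ∀ i, IdentDistrib (Y i) (Y 0) P P)
    (hint : Integrable (Y 0) P) {p : ℝ} (hp0 : 0 ≤ p) (hp : p ≤ 2)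
    (hintp : Integrable (fun ω => Y 0 ω ^ p) P) {t y : ℝ} (ht : 0 ≤ t) (hy : 0 ≤ y)
    (n : ℕ) (a : ℝ) :
    P.real {ω | a ≤ ∑ i ∈ Finset.range n, min (Y i ω) y} ≤
      Real.exp (-t * a + n * (t * (∫ ω, Y 0 ω ∂P) +
        t ^ 2 * Real.exp (t * y) * y ^ (2 - p) * ∫ ω, Y 0 ω ^ p ∂P)) := by
  set Z : ℕ → Ω → ℝ := fun i ω => min (Y i ω) y with hZ
  have hmin : Measurable fun u : ℝ => min u y := by fun_prop
  have hZm : ∀ i, Measurable (Z i) := fun i => hmin.comp (hm i)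
  have hZind : iIndepFun Z P := hind.comp (fun _ u => min u y) fun _ => hmin
  have hZid : ∀ i, IdentDistrib (Z i) (Z 0) P P := fun i => (hid i).comp hmin
  have hZ0 : ∀ i ω, 0 ≤ Z i ω := fun i ω => le_min (h0 i ω) hy
  have hZy : ∀ i ω, Z i ω ≤ y := fun i ω => min_le_right _ _
  have hb : ∀ ω, Real.exp (t * Z 0 ω) ≤ 1 + t * Y 0 ω +
      t ^ 2 * Real.exp (t * y) * y ^ (2 - p) * Y 0 ω ^ p := by
    intro ω
    have hle : Real.exp (t * Z 0 ω) ≤ Real.exp (t * y) := by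
      gcongr; exact hZy 0 ω
    -- Truncation trades the possibly infinite second moment for the `p`-th one.
    have hsq : Z 0 ω ^ 2 ≤ y ^ (2 - p) * Y 0 ω ^ p := by
      rcases (hZ0 0 ω).eq_or_lt with h | h
      · rw [← h]
        have := h0 0 ω
        simp only [ne_eq, OfNat.ofNat_ne_zero, not_false_eq_true, zero_pow]
        positivity
      · have hYZ : Z 0 ω ≤ Y 0 ω := min_le_left _ _
        calc Z 0 ω ^ 2 = Z 0 ω ^ (2 - p) * Z 0 ω ^ p := by
              rw [← Real.rpow_add h]; norm_num
          _ ≤ _ := by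
            have h2 := hZy 0 ω
            have h3 : 0 ≤ 2 - p := by linarith
            gcongr
    have hexp := Real.exp_le_one_add_add_sq_mul_exp (mul_nonneg ht (hZ0 0 ω))
    have hYZ : Z 0 ω ≤ Y 0 ω := min_le_left _ _
    calc _ ≤ 1 + t * Z 0 ω + t ^ 2 * Z 0 ω ^ 2 * Real.exp (t * Z 0 ω) := by
          rw [← mul_pow]; exact hexp
      _ ≤ 1 + t * Y 0 ω + t ^ 2 * (y ^ (2 - p) * Y 0 ω ^ p) * Real.exp (t * y) := by
          have := h0 0 ω
          gcongr
      _ = _ := by ring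
  have hZint : ∀ i, Integrable (fun ω => Real.exp (t * Z i ω)) P := fun i =>
    Integrable.of_bound (C := Real.exp (t * y)) ((hZm i).const_mul t).exp.aestronglyMeasurable
      (Eventually.of_forall fun ω => by
        rw [Real.norm_of_nonneg (Real.exp_pos _).le]
        gcongr; exact hZy i ω)
  set K := t * (∫ ω, Y 0 ω ∂P) + t ^ 2 * Real.exp (t * y) * y ^ (2 - p) * ∫ ω, Y 0 ω ^ p ∂P with hK
  have hmgf : mgf (Z 0) P t ≤ Real.exp K := by
    have h1 : Integrable (fun ω => 1 + t * Y 0 ω) P := (integrable_const 1).add (hint.const_mul t)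
    calc mgf (Z 0) P t ≤ ∫ ω, (1 + t * Y 0 ω +
          t ^ 2 * Real.exp (t * y) * y ^ (2 - p) * Y 0 ω ^ p) ∂P :=
          integral_mono (hZint 0) (h1.add (hintp.const_mul _)) hb
      _ = 1 + K := by
        rw [integral_add h1 (hintp.const_mul _), integral_add (integrable_const 1)
          (hint.const_mul t), integral_const_mul, integral_const_mul, hK]
        simp; ring
      _ ≤ _ := by linarith [Real.add_one_le_exp K]
  have hmgfi : ∀ i, mgf (Z i) P t = mgf (Z 0) P t := fun i => mgf_congr_of_identDistrib _ _ (hZid i) t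
  have hch := measure_ge_le_exp_mul_mgf (μ := P) (X := ∑ i ∈ Finset.range n, Z i) a ht
    (hZind.integrable_exp_mul_sum hZm fun i _ => hZint i)
  rw [hZind.mgf_sum hZm, Finset.prod_congr rfl fun i _ => hmgfi i, Finset.prod_const,
    Finset.card_range] at hch
  simp only [Finset.sum_apply] at hch
  refine hch.trans ?_
  rw [Real.exp_add, Real.exp_nat_mul]
  gcongr
  exact mgf_nonneg

/-- The sum of about `x / q` independent non-negative random variables with mean less than `q`,
truncated at a small multiple of `x`, exceeds almost `x` only with a probability of order
`x ^ (-r)`. -/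
theorem exists_eventually_measureReal_le_sum_min_le {Ω : Type*} [MeasurableSpace Ω]
    {P : Measure Ω} [IsProbabilityMeasure P] {Y : ℕ → Ω → ℝ} (hm : ∀ i, Measurable (Y i))
    (h0 : ∀ i ω, 0 ≤ Y i ω) (hind : iIndepFun Y P) (hid : ∀ i, IdentDistrib (Y i) (Y 0) P P)
    (hint : Integrable (Y 0) P) {p : ℝ} (hp1 : 1 < p) (hp : p ≤ 2)
    (hintp : Integrable (fun ω => Y 0 ω ^ p) P) {q : ℝ} (hq : ∫ ω, Y 0 ω ∂P < q)
    {r : ℝ} (hr : 0 < r) :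
    ∃ η > 0, ∀ᶠ x : ℝ in atTop,
      P.real {ω | (1 - η) * x ≤ ∑ i ∈ Finset.range ⌊x / q⌋₊, min (Y i ω) (η * x)} ≤
        Real.exp 1 * x ^ (-r) := by
  set m := ∫ ω, Y 0 ω ∂P with hmdef
  set M := ∫ ω, Y 0 ω ^ p ∂P with hMdef
  have hm0 : 0 ≤ m := integral_nonneg (h0 0)
  have hM0 : 0 ≤ M := integral_nonneg fun ω => Real.rpow_nonneg (h0 0 ω) p
  have hq0 : 0 < q := hm0.trans_lt hq
  obtain ⟨κ, hκ⟩ : ∃ κ, κ = (1 - m / q) / 2 := ⟨_, rfl⟩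
  have hκ0 : 0 < κ := by
    have : m / q < 1 := (div_lt_one hq0).2 hq
    rw [hκ]; linarith
  obtain ⟨c, hc⟩ : ∃ c, c = (p - 1) / 2 := ⟨_, rfl⟩
  have hc0 : 0 < c := by rw [hc]; linarith
  -- With `t = c * log x / (η * x)`, `exp (t * η * x) = x ^ c`. The linear part of the exponent is
  -- at most `-(c * κ / η) * log x`, so `η ≤ c * κ / r` yields `x ^ (-r)`; the quadratic part is of
  -- order `log x ^ 2 * x ^ (-c)` because `2 * c = p - 1`, and is eventually at most 1.
  obtain ⟨η, hη⟩ : ∃ η, η = min κ (c * κ / r) := ⟨_, rfl⟩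
  have hη0 : 0 < η := by rw [hη]; exact lt_min hκ0 (by positivity)
  have hηκ : η ≤ κ := by rw [hη]; exact min_le_left _ _
  have hηr : η * r ≤ c * κ := by
    rw [← le_div_iff₀ hr, hη]; exact min_le_right _ _
  have hrem : Tendsto (fun x : ℝ => 1 / q * (c / η) ^ 2 * η ^ (2 - p) * M *
      (Real.log x ^ 2 / x ^ c)) atTop (𝓝 0) := by
    have h := (isLittleO_log_rpow_rpow_atTop 2 hc0).tendsto_div_nhds_zero
    simpa using h.const_mul (1 / q * (c / η) ^ 2 * η ^ (2 - p) * M)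
  refine ⟨η, hη0, ?_⟩
  filter_upwards [hrem.eventually (ge_mem_nhds one_pos), eventually_gt_atTop 1] with x hx hx1
  have hx0 : 0 < x := by linarith
  have hlog : 0 < Real.log x := Real.log_pos hx1
  obtain ⟨t, ht⟩ : ∃ t, t = c * Real.log x / (η * x) := ⟨_, rfl⟩
  have ht0 : 0 ≤ t := by rw [ht]; positivity
  refine (measureReal_le_sum_min_le hm h0 hind hid hint (by linarith) hp hintp ht0
    (by positivity : 0 ≤ η * x) _ _).trans ?_
  rw [← hmdef, ← hMdef, Real.rpow_def_of_pos hx0, ← Real.exp_add]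
  refine Real.exp_le_exp.2 ?_
  have hexp : Real.exp (t * (η * x)) = x ^ c := by
    rw [Real.rpow_def_of_pos hx0, ht]
    congr 1
    field_simp
  rw [hexp]
  have hfl : (⌊x / q⌋₊ : ℝ) ≤ x / q := Nat.floor_le (by positivity)
  have h2 : x / q * (t ^ 2 * x ^ c * (η * x) ^ (2 - p) * M) ≤ 1 := by
    refine le_trans (le_of_eq ?_) hx
    have e1 : x ^ (2 - p) = x / (x ^ c * x ^ c) := by
      rw [← Real.rpow_add hx0, hc, show 2 - p = 1 - ((p - 1) / 2 + (p - 1) / 2) by ring,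
        Real.rpow_sub hx0, Real.rpow_one]
    have hxc : 0 < x ^ c := by positivity
    rw [Real.mul_rpow hη0.le hx0.le, e1, ht]
    field_simp
  have h1 : -t * ((1 - η) * x) + x / q * (t * m) ≤ Real.log x * -r := by
    have e1 : -t * ((1 - η) * x) + x / q * (t * m) = -(t * x * (1 - η - m / q)) := by ring
    have e2 : t * x * κ ≤ t * x * (1 - η - m / q) := by
      gcongr
      rw [hκ] at hηκ ⊢; linarith
    have e3 : t * x * κ = Real.log x * (c * κ / η) := by rw [ht]; field_simp
    have e4 : r ≤ c * κ / η := (le_div_iff₀ hη0).2 (by linarith)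
    have e5 := mul_le_mul_of_nonneg_left e4 hlog.le
    linarith
  have h3 : (⌊x / q⌋₊ : ℝ) * (t * m + t ^ 2 * x ^ c * (η * x) ^ (2 - p) * M) ≤
      x / q * (t * m + t ^ 2 * x ^ c * (η * x) ^ (2 - p) * M) := by gcongr
  linarith

theorem measureReal_lt_le_rpow {Ω : Type*} [MeasurableSpace Ω] {P : Measure Ω}
    [IsFiniteMeasure P] {Y : Ω → ℝ} (h0 : ∀ ω, 0 ≤ Y ω) {r : ℝ} (hr : 0 < r)
    (hint : Integrable (fun ω => Y ω ^ r) P) {η x : ℝ} (hη : 0 < η) (hx : 0 < x) :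
    P.real {ω | η * x < Y ω} ≤ η ^ (-r) * (∫ ω, Y ω ^ r ∂P) * x ^ (-r) := by
  have h := mul_meas_ge_le_integral_of_nonneg
    (Eventually.of_forall fun ω => Real.rpow_nonneg (h0 ω) r) hint ((η * x) ^ r)
  have hsub : P.real {ω | η * x < Y ω} ≤ P.real {ω | (η * x) ^ r ≤ Y ω ^ r} := by
    refine measureReal_mono fun ω hω => ?_
    have hω' : η * x < Y ω := hω
    show (η * x) ^ r ≤ Y ω ^ r
    gcongr
  have hpos : 0 < (η * x) ^ r := by positivity
  have e : η ^ (-r) * (∫ ω, Y ω ^ r ∂P) * x ^ (-r) = (∫ ω, Y ω ^ r ∂P) / (η * x) ^ r := by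
    rw [Real.mul_rpow hη.le hx.le, Real.rpow_neg hη.le, Real.rpow_neg hx.le]; field_simp
  rw [e, le_div_iff₀ hpos]
  nlinarith

theorem antitone_measureReal_lt {Ω : Type*} [MeasurableSpace Ω] (P : Measure Ω)
    [IsFiniteMeasure P] (Y : Ω → ℝ) : Antitone fun x : ℝ => P.real {ω | x < Y ω} :=
  fun _ _ hxy => measureReal_mono fun _ hω => lt_of_le_of_lt hxy hω

/-! ### Tail of a random sum -/

section RandomSum

variable {Ω : Type*} [MeasurableSpace Ω] {P : Measure Ω} [IsProbabilityMeasure P]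
  {N e : Ω → ℕ} {ξ : ℕ → Ω → ℕ} {β r q : ℝ}

/-- Upper bound for the tail of a random sum with a regularly varying number of terms. -/
theorem exists_tail_randomSum_le (hN : IsRegularlyVaryingRV (fun ω => (N ω : ℝ)) β P)
    (hξm : ∀ i, Measurable (ξ i)) (hind : iIndepFun ξ P)
    (hid : ∀ i, IdentDistrib (ξ i) (ξ 0) P P) (hNξ : ∀ i, IndepFun N (ξ i) P)
    (hr : max 1 β < r) (hξ : Integrable (fun ω => (ξ 0 ω : ℝ)) P)
    (hξr : Integrable (fun ω => (ξ 0 ω : ℝ) ^ r) P) (her : Integrable (fun ω => (e ω : ℝ) ^ r) P)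
    (hq : ∫ ω, (ξ 0 ω : ℝ) ∂P < q) :
    ∃ h : ℝ → ℝ, Tendsto h atTop (𝓝 0) ∧ ∀ᶠ x in atTop,
      P.real {ω | x < (((∑ i ∈ Finset.range (N ω), ξ i ω) + e ω : ℕ) : ℝ)} /
        P.real {ω | x < (N ω : ℝ)} ≤
      P.real {ω | x / q < (N ω : ℝ)} / P.real {ω | x < (N ω : ℝ)} + h x := by
  obtain ⟨hr1, hrβ⟩ := max_lt_iff.1 hr
  have hr0 : 0 < r := by linarith
  have hcast : Measurable fun k : ℕ => (k : ℝ) := measurable_from_top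
  set F : ℝ → ℝ := fun x => P.real {ω | x < (N ω : ℝ)} with hFdef
  have hF : IsRegularlyVarying F (-β) := hN.tail
  have anti : Antitone F := antitone_measureReal_lt P _
  have hF1 : ∀ x, F x ≤ 1 := fun x => measureReal_le_one
  have hq0 : 0 < q := lt_of_le_of_lt (integral_nonneg fun ω => Nat.cast_nonneg _) hq
  -- The Chernoff bound needs an exponent in `(1, 2]`, while `r` may exceed 2.
  have hp1 : 1 < min r 2 := lt_min hr1 one_lt_two
  have hintp : Integrable (fun ω => (ξ 0 ω : ℝ) ^ (min r 2)) P := by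
    refine hξr.mono' ((hcast.comp (hξm 0)).pow_const _).aestronglyMeasurable
      (Eventually.of_forall fun ω => ?_)
    rw [Real.norm_of_nonneg (by positivity)]
    rcases Nat.eq_zero_or_pos (ξ 0 ω) with h | h
    · rw [h, Nat.cast_zero, Real.zero_rpow (by linarith), Real.zero_rpow hr0.ne']
    · exact Real.rpow_le_rpow_of_exponent_le (by exact_mod_cast h) (min_le_left _ _)
  obtain ⟨η, hη, hD⟩ := exists_eventually_measureReal_le_sum_min_le
    (Y := fun i ω => (ξ i ω : ℝ)) (fun i => hcast.comp (hξm i)) (fun i ω => Nat.cast_nonneg _)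
    (hind.comp (fun _ k => (k : ℝ)) fun _ => hcast) (fun i => (hid i).comp hcast) hξ hp1
    (min_le_right _ _) hintp hq hr0
  set A := η ^ (-r) * ∫ ω, (ξ 0 ω : ℝ) ^ r ∂P with hA
  set B := η ^ (-r) * ∫ ω, (e ω : ℝ) ^ r ∂P with hB
  refine ⟨fun x => (B + Real.exp 1) * (x ^ (-r) / F x) +
    A * (x ^ (-r) * (∑ i ∈ Finset.range ⌊x / q⌋₊, F (((i : ℝ) + 1) / 2)) / F x), ?_, ?_⟩
  · have h := ((hF.tendsto_rpow_neg_div anti hF1 hN.index_nonneg hrβ).const_mul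
      (B + Real.exp 1)).add
      ((hF.tendsto_rpow_neg_mul_sum_div anti hF1 hr hq0).const_mul A)
    simpa using h
  filter_upwards [hD, eventually_gt_atTop 0] with x hDx hx
  have hFx := hF.pos x hx
  set L := ⌊x / q⌋₊ with hL
  have hsub : {ω | x < (((∑ i ∈ Finset.range (N ω), ξ i ω) + e ω : ℕ) : ℝ)} ⊆
      {ω | x / q < (N ω : ℝ)} ∪ {ω | η * x < (e ω : ℝ)} ∪
      (⋃ i ∈ Finset.range L, {ω | i < N ω} ∩ {ω | η * x < (ξ i ω : ℝ)}) ∪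
      {ω | (1 - η) * x ≤ ∑ i ∈ Finset.range L, min (ξ i ω : ℝ) (η * x)} := by
    intro ω hω
    by_contra hnot
    simp only [Set.mem_union, Set.mem_ofPred_eq, Set.mem_iUnion, Set.mem_inter_iff, not_or,
      not_exists, not_and, not_lt, not_le, Finset.mem_range] at hnot hω
    obtain ⟨⟨⟨h1, h2⟩, h3⟩, h4⟩ := hnot
    have hNL : N ω ≤ L := Nat.le_floor h1
    have h5 : ∑ i ∈ Finset.range (N ω), (ξ i ω : ℝ) ≤
        ∑ i ∈ Finset.range L, min (ξ i ω : ℝ) (η * x) := by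
      calc _ = ∑ i ∈ Finset.range (N ω), min (ξ i ω : ℝ) (η * x) := by
            refine Finset.sum_congr rfl fun i hi => (min_eq_left ?_).symm
            have hi' := Finset.mem_range.1 hi
            exact h3 i (hi'.trans_le hNL) hi'
        _ ≤ _ := Finset.sum_le_sum_of_subset_of_nonneg (Finset.range_mono hNL)
            fun i _ _ => le_min (Nat.cast_nonneg _) (by positivity)
    push_cast at hω
    linarith
  -- Keeping `{i < N}` is essential: a plain union bound over `L` terms has order `x ^ (1 - r)`,
  -- which need not be negligible against `F x`.
  have hC : P.real (⋃ i ∈ Finset.range L, {ω | i < N ω} ∩ {ω | η * x < (ξ i ω : ℝ)}) ≤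
      A * x ^ (-r) * ∑ i ∈ Finset.range L, F (((i : ℝ) + 1) / 2) := by
    refine (measureReal_biUnion_finset_le _ _).trans ?_
    rw [Finset.mul_sum]
    refine Finset.sum_le_sum fun i _ => ?_
    have e1 : P.real ({ω | i < N ω} ∩ {ω | η * x < (ξ i ω : ℝ)}) =
        P.real {ω | i < N ω} * P.real {ω | η * x < (ξ i ω : ℝ)} := by
      have := (hNξ i).measure_inter_preimage_eq_mul {k | i < k} {k | η * x < (k : ℝ)}
        (MeasurableSet.of_discrete) (MeasurableSet.of_discrete)
      simpa [Measure.real, ENNReal.toReal_mul] using congrArg ENNReal.toReal this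
    have e2 : P.real {ω | η * x < (ξ i ω : ℝ)} = P.real {ω | η * x < (ξ 0 ω : ℝ)} :=
      congrArg ENNReal.toReal
        ((hid i).measure_mem_eq (s := {k | η * x < (k : ℝ)}) MeasurableSet.of_discrete)
    -- Halving `i + 1` turns `N ≥ i + 1` into a strict inequality and keeps the argument positive at
    -- `i = 0`.
    have e3 : P.real {ω | i < N ω} ≤ F (((i : ℝ) + 1) / 2) := by
      refine measureReal_mono fun ω hω => ?_
      have : (i : ℝ) + 1 ≤ N ω := by exact_mod_cast (hω : i < N ω)
      show ((i : ℝ) + 1) / 2 < N ω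
      have : (0 : ℝ) ≤ i := Nat.cast_nonneg _
      linarith
    have e4 := measureReal_lt_le_rpow (fun ω => Nat.cast_nonneg (ξ 0 ω)) hr0 hξr hη hx
    rw [e1, e2, mul_comm]
    gcongr
  have hBx := measureReal_lt_le_rpow (fun ω => Nat.cast_nonneg (e ω)) hr0 her hη hx
  have hG : P.real {ω | x < (((∑ i ∈ Finset.range (N ω), ξ i ω) + e ω : ℕ) : ℝ)} ≤
      F (x / q) + B * x ^ (-r) + A * x ^ (-r) * ∑ i ∈ Finset.range L, F (((i : ℝ) + 1) / 2) +
        Real.exp 1 * x ^ (-r) := by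
    refine (measureReal_mono hsub).trans ((measureReal_union_le _ _).trans ?_)
    refine add_le_add ((measureReal_union_le _ _).trans ?_) hDx
    refine add_le_add ((measureReal_union_le _ _).trans ?_) hC
    exact add_le_add le_rfl hBx
  calc _ ≤ (F (x / q) + B * x ^ (-r) +
        A * x ^ (-r) * ∑ i ∈ Finset.range L, F (((i : ℝ) + 1) / 2) + Real.exp 1 * x ^ (-r)) /
        F x := div_le_div_of_nonneg_right hG hFx.le
    _ = F (x / q) / F x + ((B + Real.exp 1) * (x ^ (-r) / F x) +
        A * (x ^ (-r) * (∑ i ∈ Finset.range L, F (((i : ℝ) + 1) / 2)) / F x)) := by ring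

/-- Lower bound for the tail of a random sum with a regularly varying number of terms. -/
theorem exists_le_tail_randomSum
    (hξm : ∀ i, Measurable (ξ i)) (hind : iIndepFun ξ P)
    (hid : ∀ i, IdentDistrib (ξ i) (ξ 0) P P)
    (hNξ : ∀ k, IndepFun N (fun ω => ∑ i ∈ Finset.range k, ξ i ω) P)
    (hξ : Integrable (fun ω => (ξ 0 ω : ℝ)) P) (hq0 : 0 < q) (hq : q < ∫ ω, (ξ 0 ω : ℝ) ∂P) :
    ∃ g : ℝ → ℝ, Tendsto g atTop (𝓝 1) ∧ ∀ᶠ x in atTop, P.real {ω | x / q < (N ω : ℝ)} * g x ≤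
      P.real {ω | x < (((∑ i ∈ Finset.range (N ω), ξ i ω) + e ω : ℕ) : ℝ)} := by
  have hcast : Measurable fun k : ℕ => (k : ℝ) := measurable_from_top
  set m := ∫ ω, (ξ 0 ω : ℝ) ∂P with hm
  have hsm : ∀ k, Measurable fun ω => (∑ i ∈ Finset.range k, (ξ i ω : ℝ)) / (k : ℝ) := fun k =>
    (Finset.measurable_fun_sum _ fun i _ => hcast.comp (hξm i)).div_const _
  have hlln := strong_law_ae_real (fun i ω => (ξ i ω : ℝ)) hξ
    (fun i j hij => (hind.indepFun hij).comp hcast hcast) fun i => (hid i).comp hcast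
  have hprob := tendstoInMeasure_iff_norm.1
    (tendstoInMeasure_of_tendsto_ae (fun k => (hsm k).aestronglyMeasurable) hlln) (m - q)
    (by linarith)
  have hprob' := ((ENNReal.tendsto_toReal ENNReal.zero_ne_top).comp hprob).const_sub 1
  rw [ENNReal.toReal_zero, sub_zero] at hprob'
  -- `⌊x / q⌋₊ + 1` is the least integer above `x / q`, so `N > x / q` means that at least this many
  -- summands are present.
  have hK : Tendsto (fun x : ℝ => ⌊x / q⌋₊ + 1) atTop atTop :=
    (tendsto_add_atTop_nat 1).comp
      (tendsto_nat_floor_atTop.comp (tendsto_id.atTop_div_const hq0))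
  refine ⟨_, hprob'.comp hK, ?_⟩
  filter_upwards [eventually_gt_atTop 0] with x hx
  set K := ⌊x / q⌋₊ + 1 with hKdef
  have hK0 : (0 : ℝ) < K := by positivity
  have hKx : x < K * q := by
    rw [← div_lt_iff₀ hq0, hKdef]
    exact_mod_cast Nat.lt_floor_add_one (x / q)
  set T : Set Ω := {ω | x < ((∑ i ∈ Finset.range K, ξ i ω : ℕ) : ℝ)} with hT
  have hTm : MeasurableSet T :=
    measurableSet_lt measurable_const
      (hcast.comp (Finset.measurable_fun_sum _ fun i _ => hξm i))
  -- Off `T` the average of `K` terms is at most `x / K < q`, a deviation of at least `m - q` from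
  -- the mean.
  have h1 : 1 - P.real {ω | m - q ≤
      ‖(∑ i ∈ Finset.range K, (ξ i ω : ℝ)) / (K : ℝ) - m‖} ≤ P.real T := by
    have hc : P.real Tᶜ ≤ P.real {ω | m - q ≤
        ‖(∑ i ∈ Finset.range K, (ξ i ω : ℝ)) / (K : ℝ) - m‖} := by
      refine measureReal_mono fun ω hω => ?_
      have hω' : (∑ i ∈ Finset.range K, (ξ i ω : ℝ)) ≤ x := by
        have : ((∑ i ∈ Finset.range K, ξ i ω : ℕ) : ℝ) ≤ x := not_lt.1 fun h => hω h
        exact_mod_cast this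
      have : (∑ i ∈ Finset.range K, (ξ i ω : ℝ)) / (K : ℝ) ≤ q := by
        rw [div_le_iff₀ hK0]; linarith
      show m - q ≤ ‖_‖
      rw [Real.norm_eq_abs, abs_sub_comm]
      exact le_trans (by linarith) (le_abs_self _)
    have := probReal_add_probReal_compl (μ := P) hTm
    linarith
  have hmul : P.real ({ω | x / q < (N ω : ℝ)} ∩ T) = P.real {ω | x / q < (N ω : ℝ)} * P.real T := by
    have := (hNξ K).measure_inter_preimage_eq_mul {k | x / q < (k : ℝ)} {k | x < (k : ℝ)}
      MeasurableSet.of_discrete MeasurableSet.of_discrete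
    exact (congrArg ENNReal.toReal this).trans ENNReal.toReal_mul
  calc _ ≤ P.real {ω | x / q < (N ω : ℝ)} * P.real T := by
        gcongr
        exact h1
    _ = P.real ({ω | x / q < (N ω : ℝ)} ∩ T) := hmul.symm
    _ ≤ _ := by
      refine measureReal_mono fun ω hω => ?_
      have hNK : K ≤ N ω := (Nat.floor_lt (by positivity)).2 hω.1
      have hTω : x < ((∑ i ∈ Finset.range K, ξ i ω : ℕ) : ℝ) := hω.2
      refine hTω.trans_le (Nat.cast_le.2 ?_)
      exact (Finset.sum_le_sum_of_subset (Finset.range_mono hNK)).trans (Nat.le_add_right _ _)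

/-- The tail of a random sum with a regularly varying number of terms. -/
theorem tendsto_tail_randomSum_div (hN : IsRegularlyVaryingRV (fun ω => (N ω : ℝ)) β P)
    (hξm : ∀ i, Measurable (ξ i)) (hind : iIndepFun ξ P)
    (hid : ∀ i, IdentDistrib (ξ i) (ξ 0) P P) (hNξ : ∀ i, IndepFun N (ξ i) P)
    (hNξs : ∀ k, IndepFun N (fun ω => ∑ i ∈ Finset.range k, ξ i ω) P)
    (hr : max 1 β < r) (hξ : Integrable (fun ω => (ξ 0 ω : ℝ)) P)
    (hξr : Integrable (fun ω => (ξ 0 ω : ℝ) ^ r) P) (her : Integrable (fun ω => (e ω : ℝ) ^ r) P)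
    (hpos : 0 < ∫ ω, (ξ 0 ω : ℝ) ∂P) :
    Tendsto (fun x => P.real {ω | x < (((∑ i ∈ Finset.range (N ω), ξ i ω) + e ω : ℕ) : ℝ)} /
      P.real {ω | x < (N ω : ℝ)}) atTop (𝓝 ((∫ ω, (ξ 0 ω : ℝ) ∂P) ^ β)) := by
  have hcont : ContinuousAt (fun q : ℝ => q ^ β) (∫ ω, (ξ 0 ω : ℝ) ∂P) :=
    Real.continuousAt_rpow_const _ _ (Or.inl hpos.ne')
  -- By continuity of `q ^ β` at the mean, `q` slightly below it serves the lower estimate and `q`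
  -- slightly above it the upper one.
  refine tendsto_order.2 ⟨fun a ha => ?_, fun a ha => ?_⟩
  · obtain ⟨q, ⟨hqa, hq0⟩, hq⟩ := ((((hcont.eventually (lt_mem_nhds ha)).and
      (lt_mem_nhds hpos)).filter_mono nhdsWithin_le_nhds).and
      (self_mem_nhdsWithin (s := Set.Iio (∫ ω, (ξ 0 ω : ℝ) ∂P)))).exists
    obtain ⟨g, hg, hle⟩ := exists_le_tail_randomSum (N := N) (e := e) hξm hind hid hNξs hξ hq0 hq
    have hlim := (hN.tail.tendsto_comp_div hq0).mul hg
    rw [mul_one] at hlim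
    filter_upwards [hlim.eventually (lt_mem_nhds hqa), hle, eventually_gt_atTop 0] with x h1 h2 hx
    have hFx := hN.tail.pos x hx
    refine h1.trans_le ?_
    rw [div_mul_eq_mul_div]
    exact div_le_div_of_nonneg_right h2 hFx.le
  · obtain ⟨q, hqa, hq⟩ := (((hcont.eventually (gt_mem_nhds ha)).filter_mono
      nhdsWithin_le_nhds).and
      (self_mem_nhdsWithin (s := Set.Ioi (∫ ω, (ξ 0 ω : ℝ) ∂P)))).exists
    obtain ⟨h, hh, hle⟩ := exists_tail_randomSum_le hN hξm hind hid hNξ hr hξ hξr her hq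
    have hlim := (hN.tail.tendsto_comp_div (hpos.trans hq)).add hh
    rw [add_zero] at hlim
    filter_upwards [hlim.eventually (gt_mem_nhds hqa), hle] with x h1 h2
    exact h2.trans_lt h1

end RandomSum

/-! ### Measurability and independence in the process -/

theorem measurable_sum_range_nat {Ω : Type*} [MeasurableSpace Ω] {N : Ω → ℕ} {f : ℕ → Ω → ℕ}
    (hN : Measurable N) (hf : ∀ i, Measurable (f i)) :
    Measurable fun ω => ∑ i ∈ Finset.range (N ω), f i ω := by
  have h : Measurable fun z : ℕ × Ω => ∑ i ∈ Finset.range z.1, f i z.2 :=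
    measurable_from_prod_countable_right fun k =>
      Finset.measurable_fun_sum (Finset.range k) fun i _ => hf i
  exact h.comp (hN.prodMk measurable_id)

namespace IsGWI

variable {Ω : Type*} [mΩ : MeasurableSpace Ω] {P : Measure Ω}
  {X : ℕ → Ω → ℕ} {ξ : ℕ → ℕ → Ω → ℕ} {ε : ℕ → Ω → ℕ}

theorem measurable (hX : IsGWI X ξ ε P) (n : ℕ) : Measurable (X n) := by
  induction n with
  | zero => exact hX.measurable_init
  | succ n ih =>
    rw [show X (n + 1) = fun ω => (∑ i ∈ Finset.range (X n ω), ξ n i ω) + ε n ω from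
      funext (hX.recursion n)]
    exact (measurable_sum_range_nat ih (hX.measurable_offspring n)).add
      (hX.measurable_immigration n)

/-- The indices of the variables that determine the first `n` generations. -/
def pastIndices (n : ℕ) : Set (Unit ⊕ (ℕ × ℕ) ⊕ ℕ)
  | Sum.inl _ => True
  | Sum.inr (Sum.inl p) => p.1 < n
  | Sum.inr (Sum.inr k) => k < n

/-- Independence will come from disjoint blocks of the family, so `X n` has to be measurable for the
σ-algebra of its own block, not merely the ambient one. -/
theorem measurable_past (hX : IsGWI X ξ ε P) (n : ℕ) :
    Measurable[⨆ j ∈ pastIndices n, MeasurableSpace.comap (gwiFamily (X 0) ξ ε j) ⊤] (X n) := by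
  have hle : ∀ (l : ℕ) (j : Unit ⊕ (ℕ × ℕ) ⊕ ℕ), j ∈ pastIndices l →
      Measurable[⨆ j ∈ pastIndices l, MeasurableSpace.comap (gwiFamily (X 0) ξ ε j) ⊤]
        (gwiFamily (X 0) ξ ε j) := fun l j hj =>
    Measurable.of_comap_le
      (le_iSup₂ (f := fun j _ => MeasurableSpace.comap (gwiFamily (X 0) ξ ε j) ⊤) j hj)
  induction n with
  | zero => exact hle 0 (Sum.inl ()) trivial
  | succ n ih =>
    have hmono : (⨆ j ∈ pastIndices n, MeasurableSpace.comap (gwiFamily (X 0) ξ ε j) ⊤) ≤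
        ⨆ j ∈ pastIndices (n + 1), MeasurableSpace.comap (gwiFamily (X 0) ξ ε j) ⊤ := by
      refine biSup_mono fun j hj => ?_
      rcases j with _ | p | k
      · trivial
      · exact Nat.lt_succ_of_lt hj
      · exact Nat.lt_succ_of_lt hj
    rw [show X (n + 1) = fun ω => (∑ i ∈ Finset.range (X n ω), ξ n i ω) + ε n ω from
      funext (hX.recursion n)]
    refine @Measurable.add _ _ _ _ _ (_) _ _ (@measurable_sum_range_nat _ (_) _ _
      (ih.mono hmono le_rfl) fun i => ?_) ?_
    · exact hle (n + 1) (Sum.inr (Sum.inl (n, i))) (Nat.lt_succ_self n)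
    · exact hle (n + 1) (Sum.inr (Sum.inr n)) (Nat.lt_succ_self n)

/-- The population of generation `n` is independent of its offspring variables. -/
theorem indepFun_sum_offspring (hX : IsGWI X ξ ε P) (n : ℕ) (s : Finset ℕ) :
    IndepFun (X n) (fun ω => ∑ i ∈ s, ξ n i ω) P := by
  have hm : ∀ j, Measurable (gwiFamily (X 0) ξ ε j) := by
    rintro (_ | p | k)
    · exact hX.measurable_init
    · exact hX.measurable_offspring p.1 p.2
    · exact hX.measurable_immigration k
  have hdisj : Disjoint (pastIndices n) (Set.range fun i : ℕ => Sum.inr (Sum.inl (n, i))) := by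
    rw [Set.disjoint_right]
    rintro _ ⟨i, rfl⟩ h
    exact lt_irrefl n h
  have hI := indep_iSup_of_disjoint (fun j => (hm j).comap_le) hX.indep hdisj
  rw [IndepFun_iff_Indep]
  refine indep_of_indep_of_le_left (indep_of_indep_of_le_right hI ?_)
    (measurable_iff_comap_le.1 (hX.measurable_past n))
  refine measurable_iff_comap_le.1 (@Finset.measurable_fun_sum _ _ _ _ _ _ (_) _ s fun i _ => ?_)
  exact Measurable.of_comap_le
    (le_iSup₂ (f := fun j (_ : j ∈ Set.range fun i : ℕ => Sum.inr (Sum.inl (n, i))) =>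
      MeasurableSpace.comap (gwiFamily (X 0) ξ ε j) ⊤) (Sum.inr (Sum.inl (n, i))) ⟨i, rfl⟩)

theorem iIndepFun_offspring (hX : IsGWI X ξ ε P) (n : ℕ) : iIndepFun (ξ n) P :=
  hX.indep.precomp (g := fun i : ℕ => Sum.inr (Sum.inl (n, i))) fun i j h => by simpa using h

end IsGWI

/-! ### Transfer of regular variation and the induction -/

/-- A random variable whose tail is asymptotically proportional to a regularly varying one is
regularly varying with the same index. -/
theorem IsRegularlyVaryingRV.of_tendsto_tail_div {Ω : Type*} [MeasurableSpace Ω] {P : Measure Ω}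
    [IsProbabilityMeasure P] {Y Z : Ω → ℝ} {β c : ℝ} (hY : IsRegularlyVaryingRV Y β P)
    (hZ : Measurable Z) (hZ0 : ∀ ω, 0 ≤ Z ω) (hc : 0 < c)
    (h : Tendsto (fun x : ℝ => P.real {ω | x < Z ω} / P.real {ω | x < Y ω}) atTop (𝓝 c)) :
    IsRegularlyVaryingRV Z β P := by
  have anti := antitone_measureReal_lt P Z
  have hpos : ∀ x : ℝ, 0 < P.real {ω | x < Z ω} := by
    intro x
    -- A positive limit makes the tail of `Z` positive at some `y ≥ x`; monotonicity brings this
    -- back to `x`.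
    obtain ⟨y, hy, hxy, hy0⟩ := ((h.eventually (lt_mem_nhds hc)).and
      ((eventually_ge_atTop x).and (eventually_gt_atTop 0))).exists
    have hZy : 0 < P.real {ω | y < Z ω} := by
      by_contra hcon
      rw [le_antisymm (not_lt.1 hcon) measureReal_nonneg, zero_div] at hy
      exact lt_irrefl _ hy
    exact hZy.trans_le (anti hxy)
  refine ⟨hZ, hZ0, hY.index_nonneg, fun x _ => hpos x,
    anti.measurable.comp measurable_subtype_coe, fun q hq => ?_⟩
  have hq' : Tendsto (fun x : ℝ => q * x) atTop atTop := tendsto_id.const_mul_atTop hq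
  have hlim := ((h.comp hq').mul (hY.tail.tendsto q hq)).div h hc.ne'
  rw [mul_div_assoc, mul_div_cancel₀ _ hc.ne'] at hlim
  refine hlim.congr' ?_
  filter_upwards [eventually_gt_atTop 0] with x hx
  have h1 := (hY.tail.pos x hx).ne'
  have h2 := (hY.tail.pos (q * x) (by positivity)).ne'
  have h3 := (hpos x).ne'
  simp only [Pi.div_apply, Function.comp_apply]
  field_simp

theorem mainTheorem2 {Ω : Type*} [MeasurableSpace Ω] (P : Measure Ω) [IsProbabilityMeasure P]
    (X : ℕ → Ω → ℕ) (ξ : ℕ → ℕ → Ω → ℕ) (ε : ℕ → Ω → ℕ) (hX : IsGWI X ξ ε P)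
    (β : ℝ) (hβ : 0 ≤ β)
    (hX₀ : IsRegularlyVaryingRV (fun ω => (X 0 ω : ℝ)) β P)
    (hξ₀ : P {ω | ξ 0 0 ω = 0} < 1)
    (hr : ∃ r : ℝ, max 1 β < r ∧
      Integrable (fun ω => (ξ 0 0 ω : ℝ) ^ r) P ∧ Integrable (fun ω => (ε 0 ω : ℝ) ^ r) P)
    (n : ℕ) (hn : 1 ≤ n) :
    Tendsto (fun x : ℝ => P.real {ω | x < (X n ω : ℝ)} /
        ((∫ ω, (ξ 0 0 ω : ℝ) ∂P) ^ ((n : ℝ) * β) * P.real {ω | x < (X 0 ω : ℝ)}))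
      atTop (𝓝 1) ∧
    IsRegularlyVaryingRV (fun ω => (X n ω : ℝ)) β P := by
  obtain ⟨r, hr, hξr, hεr⟩ := hr
  obtain ⟨hr1, -⟩ := max_lt_iff.1 hr
  have hcast : Measurable fun k : ℕ => (k : ℝ) := measurable_from_top
  have hξ : Integrable (fun ω => (ξ 0 0 ω : ℝ)) P := by
    refine hξr.mono' (hcast.comp (hX.measurable_offspring 0 0)).aestronglyMeasurable
      (Eventually.of_forall fun ω => ?_)
    rw [Real.norm_of_nonneg (Nat.cast_nonneg _)]
    rcases Nat.eq_zero_or_pos (ξ 0 0 ω) with h | h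
    · rw [h, Nat.cast_zero, Real.zero_rpow (by linarith)]
    · exact Real.self_le_rpow_of_one_le (by exact_mod_cast h) hr1.le
  have hm : 0 < ∫ ω, (ξ 0 0 ω : ℝ) ∂P := by
    refine (integral_nonneg fun ω => Nat.cast_nonneg _).lt_of_ne' fun h0 => hξ₀.ne ?_
    have h1 := (integral_eq_zero_iff_of_nonneg (fun ω => Nat.cast_nonneg (ξ 0 0 ω)) hξ).1 h0
    exact (mem_ae_iff_prob_eq_one (hX.measurable_offspring 0 0 (measurableSet_singleton 0))).1
      (h1.mono fun ω hω => by simpa using hω)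
  set m := ∫ ω, (ξ 0 0 ω : ℝ) ∂P with hmdef
  -- Regular variation of `X k` is carried along because the random-sum limit for generation `k + 1`
  -- takes it as input.
  have key : ∀ k : ℕ, IsRegularlyVaryingRV (fun ω => (X k ω : ℝ)) β P ∧
      Tendsto (fun x : ℝ => P.real {ω | x < (X k ω : ℝ)} / P.real {ω | x < (X 0 ω : ℝ)})
        atTop (𝓝 (m ^ ((k : ℝ) * β))) := by
    intro k
    induction k with
    | zero =>
      refine ⟨hX₀, ?_⟩
      rw [Nat.cast_zero, zero_mul, Real.rpow_zero]
      refine tendsto_const_nhds.congr' ?_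
      filter_upwards [eventually_gt_atTop 0] with x hx
      exact (div_self (hX₀.tail.pos x hx).ne').symm
    | succ k ih =>
      obtain ⟨hk, hlim⟩ := ih
      have hid : ∀ i, IdentDistrib (ξ k i) (ξ 0 0) P P := hX.identDistrib_offspring k
      have hidr : ∀ s : ℝ, IdentDistrib (fun ω => (ξ k 0 ω : ℝ) ^ s)
          (fun ω => (ξ 0 0 ω : ℝ) ^ s) P P := fun s => (hid 0).comp (hcast.pow_const s)
      have hmk : ∫ ω, (ξ k 0 ω : ℝ) ∂P = m := ((hid 0).comp hcast).integral_eq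
      have hstep := tendsto_tail_randomSum_div (e := ε k) hk (hX.measurable_offspring k)
        (hX.iIndepFun_offspring k) (fun i => (hid i).trans (hid 0).symm)
        (fun i => by simpa using hX.indepFun_sum_offspring k {i})
        (fun l => hX.indepFun_sum_offspring k (Finset.range l)) hr
        (((hid 0).comp hcast).integrable_iff.2 hξ) ((hidr r).integrable_iff.2 hξr)
        (((hX.identDistrib_immigration k).comp (hcast.pow_const r)).integrable_iff.2 hεr)
        (by rw [hmk]; exact hm)
      rw [hmk] at hstep
      simp only [← hX.recursion] at hstep
      refine ⟨hk.of_tendsto_tail_div (hcast.comp (hX.measurable (k + 1)))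
        (fun ω => Nat.cast_nonneg _) (by positivity) hstep, ?_⟩
      have hprod := hstep.mul hlim
      rw [← Real.rpow_add hm, show β + (k : ℝ) * β = ((k + 1 : ℕ) : ℝ) * β by push_cast; ring]
        at hprod
      refine hprod.congr' ?_
      filter_upwards [eventually_gt_atTop 0] with x hx
      exact div_mul_div_cancel₀ (hk.tail.pos x hx).ne'
  refine ⟨?_, (key n).1⟩
  have hc : m ^ ((n : ℝ) * β) ≠ 0 := (Real.rpow_pos_of_pos hm _).ne'
  have h := (key n).2.div_const (m ^ ((n : ℝ) * β))
  rw [div_self hc] at h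
  refine h.congr fun x => ?_
  rw [div_div, mul_comm]
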